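/- Let $\mathscr H$ be a complex Hilbert space, let $\mathbb B(\mathscr H)$ be the algebra of bounded linear operators on $\mathscr H$, and write $S\le T$ for self-adjoint $S,T\in\mathbb B(\mathscr H)$ if $\langle (T-S)x,x\rangle\ge 0$ for all $x\in\mathscr H$. Let $A,B\in\mathbb B(\mathscr H)$ be positive operators (that is, $A\ge 0$ and $B\ge 0$; they need not be invertible), and for a positive integer $n$ put $$\mathcal K_{n,A,B}=\{U\in\mathbb B(\mathscr H): U \text{ is unitary and } A^{n}\le U^*B^{n}U\}.$$ Suppose that for some positive integer $n_0$ the set $\mathcal K_{n_0,A,B}$ is nonempty and is either compact in the strong operator topology or closed, as a subset of $\mathbb B(\mathscr H)$, in the weak operator topology. Then there exists a unitary operator $U\in\mathbb B(\mathscr H)$ such that $A^n\le U^*B^nU$ for every positive integer $n$. -/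

import Mathlib

/-- The set `𝒦_{n,A,B}` of all unitary operators `U` on `H` with `A ^ n ≤ U* B ^ n U`, as a set of
bounded operators. Here `≤` is the Loewner order and `star` is the Hilbert space adjoint. -/
def unitaryDominators {H : Type*} [NormedAddCommGroup H] [InnerProductSpace ℂ H] [CompleteSpace H]
    (n : ℕ) (A B : H →L[ℂ] H) : Set (H →L[ℂ] H) :=
  {U | U ∈ unitary (H →L[ℂ] H) ∧ A ^ n ≤ star U * B ^ n * U}

/-- A set of bounded operators is compact in the strong operator topology, the topology of
pointwise norm convergence. -/
def IsSOTCompact {H : Type*} [NormedAddCommGroup H] [InnerProductSpace ℂ H]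
    (K : Set (H →L[ℂ] H)) : Prop :=
  IsCompact (ContinuousLinearMap.toPointwiseConvergenceCLM ℂ (RingHom.id ℂ) H H '' K)

/-- A set of bounded operators is closed, as a subset of the space of all bounded operators, in the
weak operator topology. -/
def IsWOTClosed {H : Type*} [NormedAddCommGroup H] [InnerProductSpace ℂ H]
    (K : Set (H →L[ℂ] H)) : Prop :=
  IsClosed ((ContinuousLinearMapWOT.ofCLM : (H →L[ℂ] H) → H →WOT[ℂ] H) '' K)

/-! Replacing `A`, `B` by `A ^ n₀`, `B ^ n₀` reduces to `n₀ = 1`; Löwner–Heinz recovers the original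
powers at the end. If `p ≤ q` are positive and invertible, then `p ^ 2` is dominated by a unitary
conjugate of `q ^ 2` (`exists_unitary_sq_le`). Iterated squaring followed by Löwner–Heinz gives one
unitary serving all exponents up to `N`. Applied to `A + ε` and `B + ε`, this produces unitaries
which the exponent 1 places in the set assumed compact or closed. As `ε → 0` and `N → ∞`, a strong
limit along an ultrafilter serves every exponent. -/

lemma star_mul_mul_pow_of_mem_unitary {𝒜 : Type*} [Monoid 𝒜] [StarMul 𝒜] {w : 𝒜} (hw : w ∈ unitary 𝒜) (b : 𝒜) (n : ℕ) :
    (star w * b * w) ^ n = star w * b ^ n * w := by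
  induction n with
  | zero => simp [Unitary.star_mul_self_of_mem hw]
  | succ n ih =>
    rw [pow_succ, ih, pow_succ]
    calc star w * b ^ n * w * (star w * b * w) = star w * b ^ n * (w * star w) * b * w := by
          simp only [mul_assoc]
      _ = _ := by rw [Unitary.mul_star_self_of_mem hw]; simp only [mul_assoc, mul_one]

section CStar

variable {𝒜 : Type*} [CStarAlgebra 𝒜] [PartialOrder 𝒜] [StarOrderedRing 𝒜]

/-- For an invertible element `x` of a C⋆-algebra, `x x⋆` and `x⋆ x` are unitarily equivalent. -/
lemma IsUnit.exists_unitary_mul_star_self {x : 𝒜} (hx : IsUnit x) :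
    ∃ w ∈ unitary 𝒜, x * star x = w * (star x * x) * star w := by
  have hs : CFC.abs x * CFC.abs x = star x * x := CFC.abs_mul_abs x
  have hsa : star (CFC.abs x) = CFC.abs x := (CFC.abs_nonneg x).isSelfAdjoint.star_eq
  have hu : IsUnit (CFC.abs x) := by
    rw [CFC.abs, CFC.isUnit_sqrt_iff _ (star_mul_self_nonneg x)]
    exact hx.star.mul hx
  obtain ⟨u, hu⟩ := hu
  rw [← hu] at hs hsa
  have hsi : star (↑u⁻¹ : 𝒜) = ↑u⁻¹ := by
    have : star u = u := Units.ext hsa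
    rw [← Units.coe_star_inv, this]
  -- Here `u = |x|`, so `x * u⁻¹` is the polar factor of `x`: an isometry, and unitary because it is
  -- invertible.
  have h1 : star (x * ↑u⁻¹) * (x * ↑u⁻¹) = 1 := by
    rw [star_mul, hsi, mul_assoc, ← mul_assoc (star x), ← hs]
    simp [mul_assoc]
  have hwu : IsUnit (x * (↑u⁻¹ : 𝒜)) := hx.mul u⁻¹.isUnit
  refine ⟨x * ↑u⁻¹, ⟨h1, ?_⟩, ?_⟩
  · obtain ⟨v, hv⟩ := hwu
    rw [← hv] at h1 ⊢
    rw [← Units.inv_eq_of_mul_eq_one_left h1, Units.mul_inv]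
  · rw [star_mul, hsi, ← hs]
    simp [mul_assoc]

/-- For `x = √p √q`, one has `p ^ 2 ≤ √p q √p = x x⋆` and `x⋆ x = √q p √q ≤ q ^ 2`; the two middle
terms are unitarily equivalent since `x` is invertible. -/
lemma exists_unitary_sq_le {p q : 𝒜} (hp : 0 ≤ p) (hpq : p ≤ q) (hpu : IsUnit p)
    (hqu : IsUnit q) : ∃ w ∈ unitary 𝒜, p ^ 2 ≤ star w * q ^ 2 * w := by
  have hq : 0 ≤ q := hp.trans hpq
  set r := CFC.sqrt p
  set s := CFC.sqrt q
  have hr : 0 ≤ r := CFC.sqrt_nonneg p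
  have hs : 0 ≤ s := CFC.sqrt_nonneg q
  have hrr : r * r = p := CFC.sqrt_mul_sqrt_self p
  have hss : s * s = q := CFC.sqrt_mul_sqrt_self q
  have hx : IsUnit (r * s) :=
    ((CFC.isUnit_sqrt_iff p).2 hpu).mul ((CFC.isUnit_sqrt_iff q).2 hqu)
  have hstar : star (r * s) = s * r := by
    rw [star_mul, hr.isSelfAdjoint.star_eq, hs.isSelfAdjoint.star_eq]
  obtain ⟨w, hw, h⟩ := hx.exists_unitary_mul_star_self
  have h1 : p ^ 2 ≤ r * s * star (r * s) := by
    have := conjugate_le_conjugate_of_nonneg hpq hr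
    calc p ^ 2 = r * p * r := by rw [← hrr]; noncomm_ring
      _ ≤ r * q * r := this
      _ = _ := by rw [hstar, ← hss]; noncomm_ring
  have h2 : star (r * s) * (r * s) ≤ q ^ 2 := by
    have := conjugate_le_conjugate_of_nonneg hpq hs
    calc star (r * s) * (r * s) = s * p * s := by rw [hstar, ← hrr]; noncomm_ring
      _ ≤ s * q * s := this
      _ = _ := by rw [← hss]; noncomm_ring
  refine ⟨star w, Unitary.star_mem hw, ?_⟩
  rw [star_star]
  exact h1.trans (h.le.trans (star_right_conjugate_le_conjugate h2 w))

lemma exists_unitary_pow_two_pow_le {p q : 𝒜} (hp : 0 ≤ p) (hpq : p ≤ q) (hpu : IsUnit p)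
    (hqu : IsUnit q) (k : ℕ) :
    ∃ w ∈ unitary 𝒜, p ^ 2 ^ k ≤ star w * q ^ 2 ^ k * w := by
  induction k with
  | zero => exact ⟨1, one_mem _, by simpa using hpq⟩
  | succ k ih =>
    obtain ⟨w, hw, h⟩ := ih
    have hwu : IsUnit w := ⟨⟨w, star w, hw.2, hw.1⟩, rfl⟩
    obtain ⟨v, hv, h'⟩ := exists_unitary_sq_le (CStarAlgebra.pow_nonneg hp _) h (hpu.pow _)
      ((hwu.star.mul (hqu.pow _)).mul hwu)
    refine ⟨w * v, mul_mem hw hv, ?_⟩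
    rw [star_mul_mul_pow_of_mem_unitary hw, ← pow_mul, ← pow_mul, ← pow_succ] at h'
    simpa only [star_mul, mul_assoc] using h'

/-- The Löwner–Heinz inequality for natural exponents. -/
lemma pow_le_pow_of_pow_le_pow {a b : 𝒜} (ha : 0 ≤ a) (hb : 0 ≤ b) {m n : ℕ} (hn : n ≠ 0)
    (hmn : m ≤ n) (h : a ^ n ≤ b ^ n) : a ^ m ≤ b ^ m := by
  have hn' : (0 : ℝ) < n := by exact_mod_cast Nat.pos_of_ne_zero hn
  have key (c : 𝒜) (hc : 0 ≤ c) : (c ^ n) ^ ((m : ℝ) / n) = c ^ m := by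
    rw [← CFC.rpow_natCast c n, CFC.rpow_rpow_of_exponent_nonneg c _ _ hn'.le (by positivity),
      mul_div_cancel₀ _ hn'.ne', CFC.rpow_natCast c m]
  rw [← key a ha, ← key b hb]
  exact CFC.rpow_le_rpow ⟨by positivity, div_le_one_of_le₀ (by exact_mod_cast hmn) hn'.le⟩ h

/-- The shift by `ε` supplies invertibility and commutes with conjugation by unitaries. A single `w`
obtained at exponent `2 ^ N` handles all `m ≤ N` by Löwner–Heinz. -/
lemma exists_unitary_forall_pow_le {a b v : 𝒜} (ha : 0 ≤ a) (hb : 0 ≤ b) (hv : v ∈ unitary 𝒜)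
    (hab : a ≤ star v * b * v) {ε : ℝ} (hε : 0 < ε) (N : ℕ) :
    ∃ w ∈ unitary 𝒜, ∀ m ≤ N,
      (a + algebraMap ℝ 𝒜 ε) ^ m ≤ star w * (b + algebraMap ℝ 𝒜 ε) ^ m * w := by
  have hεp : IsStrictlyPositive (algebraMap ℝ 𝒜 ε) := by
    refine IsStrictlyPositive.iff_of_unital.2 ⟨algebraMap_nonneg 𝒜 hε.le, ?_⟩
    exact (isUnit_iff_ne_zero.2 hε.ne').map _
  have hcomm (x : 𝒜) (hx : x ∈ unitary 𝒜) :
      star x * (b + algebraMap ℝ 𝒜 ε) * x = star x * b * x + algebraMap ℝ 𝒜 ε := by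
    rw [mul_add, add_mul, ← Algebra.commutes ε (star x), mul_assoc (algebraMap ℝ 𝒜 ε),
      Unitary.star_mul_self_of_mem hx, mul_one]
  have hp : IsStrictlyPositive (a + algebraMap ℝ 𝒜 ε) := hεp.nonneg_add ha
  have hq : IsStrictlyPositive (star v * b * v + algebraMap ℝ 𝒜 ε) :=
    hεp.nonneg_add (star_left_conjugate_nonneg hb v)
  obtain ⟨u, hu, h⟩ := exists_unitary_pow_two_pow_le hp.nonneg (add_le_add_left hab _) hp.isUnit
    hq.isUnit N
  have hvu : v * u ∈ unitary 𝒜 := mul_mem hv hu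
  have hb' : 0 ≤ b + algebraMap ℝ 𝒜 ε := (hεp.nonneg_add hb).nonneg
  rw [← hcomm v hv, star_mul_mul_pow_of_mem_unitary hv] at h
  refine ⟨v * u, hvu, fun m hm => ?_⟩
  rw [← star_mul_mul_pow_of_mem_unitary hvu]
  refine pow_le_pow_of_pow_le_pow hp.nonneg (star_left_conjugate_nonneg hb' _)
    (pow_ne_zero N two_ne_zero) (hm.trans N.lt_two_pow_self.le) ?_
  rw [star_mul_mul_pow_of_mem_unitary hvu]
  simpa only [star_mul, mul_assoc] using h

end CStar

section Limit

open Filter Topology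

variable {H : Type*} [NormedAddCommGroup H] [InnerProductSpace ℂ H]

local notation "⟪" x ", " y "⟫" => inner ℂ x y

/-- Along an ultrafilter, a bounded family of operators has a weak operator limit. -/
lemma exists_forall_tendsto_inner [CompleteSpace H] {ι : Type*} (F : Ultrafilter ι)
    (T : ι → H →L[ℂ] H) (c : ℝ) (hT : ∀ i, ‖T i‖ ≤ c) :
    ∃ S : H →L[ℂ] H, ∀ x y, Tendsto (fun i => ⟪y, T i x⟫) F (𝓝 ⟪y, S x⟫) := by
  have hbd (x y : H) (i : ι) : ‖⟪T i x, y⟫‖ ≤ c * ‖x‖ * ‖y‖ :=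
    (norm_inner_le_norm _ _).trans (by gcongr; exact (T i).le_of_opNorm_le (hT i) x)
  have hex (x y : H) : ∃ z : ℂ, ‖z‖ ≤ c * ‖x‖ * ‖y‖ ∧
      Tendsto (fun i => ⟪T i x, y⟫) F (𝓝 z) := by
    have hc := isCompact_closedBall (0 : ℂ) (c * ‖x‖ * ‖y‖)
    obtain ⟨z, hz, hF⟩ := hc.ultrafilter_le_nhds (F.map fun i => ⟪T i x, y⟫)
      (by
        rw [Ultrafilter.coe_map, le_principal_iff]
        exact mem_map.2 (univ_mem' fun i => by simpa using hbd x y i))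
    exact ⟨z, by simpa using hz, hF⟩
  choose b hb hlim using hex
  -- The pointwise limits form a bounded sesquilinear form, which Riesz representation turns into an
  -- operator.
  let L : H →L⋆[ℂ] H →L[ℂ] ℂ := LinearMap.mkContinuous₂
    (LinearMap.mk₂'ₛₗ (starRingEnd ℂ) (RingHom.id ℂ) b
      (fun x x' y => tendsto_nhds_unique (hlim (x + x') y)
        (by simpa [inner_add_left] using (hlim x y).add (hlim x' y)))
      (fun a x y => tendsto_nhds_unique (hlim (a • x) y)
        (by simpa [inner_smul_left, mul_comm] using (hlim x y).const_mul (starRingEnd ℂ a)))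
      (fun x y y' => tendsto_nhds_unique (hlim x (y + y'))
        (by simpa [inner_add_right] using (hlim x y).add (hlim x y')))
      (fun a x y => tendsto_nhds_unique (hlim x (a • y))
        (by simpa [inner_smul_right] using (hlim x y).const_mul a))) c
    (fun x y => hb x y)
  refine ⟨InnerProductSpace.continuousLinearMapOfBilin L, fun x y => ?_⟩
  have h : ⟪InnerProductSpace.continuousLinearMapOfBilin L x, y⟫ = b x y :=
    InnerProductSpace.continuousLinearMapOfBilin_apply L x y
  have := (hlim x y).star
  rw [← h] at this
  simpa only [RCLike.star_def, inner_conj_symm] using this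

/-- A weak limit of vectors whose norms do not exceed the norm of the limit is a strong limit. -/
lemma tendsto_of_tendsto_inner {ι : Type*} {F : Filter ι} {u : ι → H} {z : H}
    (hu : ∀ i, ‖u i‖ = ‖z‖) (h : ∀ y, Tendsto (fun i => ⟪y, u i⟫) F (𝓝 ⟪y, z⟫)) :
    Tendsto u F (𝓝 z) := by
  rw [tendsto_iff_norm_sub_tendsto_zero]
  have h1 : Tendsto (fun i => 2 * ‖z‖ ^ 2 - 2 * (⟪z, u i⟫).re) F (𝓝 0) := by
    have := (((Complex.continuous_re.tendsto _).comp (h z)).const_mul 2).const_sub (2 * ‖z‖ ^ 2)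
    have hz : (⟪z, z⟫).re = ‖z‖ ^ 2 := inner_self_eq_norm_sq (𝕜 := ℂ) z
    rw [hz, sub_self] at this
    exact this
  have h2 : (fun i => ‖u i - z‖) = fun i => √(2 * ‖z‖ ^ 2 - 2 * (⟪z, u i⟫).re) := by
    funext i
    rw [← Real.sqrt_sq (norm_nonneg (u i - z)), norm_sub_rev, norm_sub_sq (𝕜 := ℂ), hu]
    congr 1
    simp only [RCLike.re_to_complex]
    ring
  rw [h2]
  simpa [Function.comp_def] using (Real.continuous_sqrt.tendsto 0).comp h1

variable [CompleteSpace H]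

lemma norm_apply_of_mem_unitary {U : H →L[ℂ] H} (hU : U ∈ unitary (H →L[ℂ] H)) (x : H) :
    ‖U x‖ = ‖x‖ :=
  (ContinuousLinearMap.norm_map_iff_adjoint_comp_self U).2 hU.1 x

/-- A family in a set of unitaries that is compact in the strong operator topology or closed in the
weak operator topology converges strongly along any ultrafilter to a member of the set. -/
lemma exists_mem_forall_tendsto_apply {K : Set (H →L[ℂ] H)} (hKu : K ⊆ unitary (H →L[ℂ] H))
    (hK : IsSOTCompact K ∨ IsWOTClosed K) {ι : Type*} (F : Ultrafilter ι) (T : ι → H →L[ℂ] H)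
    (hT : ∀ i, T i ∈ K) : ∃ U ∈ K, ∀ x, Tendsto (fun i => T i x) F (𝓝 (U x)) := by
  rcases hK with hK | hK
  · obtain ⟨_, ⟨U, hU, rfl⟩, hF⟩ := IsCompact.ultrafilter_le_nhds hK
      (F.map fun i => ContinuousLinearMap.toPointwiseConvergenceCLM ℂ (RingHom.id ℂ) H H (T i))
      (by
        rw [Ultrafilter.coe_map, le_principal_iff]
        exact mem_map.2 (univ_mem' fun i => ⟨T i, hT i, rfl⟩))
    refine ⟨U, hU, fun x => ?_⟩
    exact ((PointwiseConvergenceCLM.evalCLM (RingHom.id ℂ) H x).continuous.tendsto _).comp hF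
  · obtain ⟨U, hU⟩ := exists_forall_tendsto_inner F T 1 fun i =>
      (T i).opNorm_le_bound zero_le_one fun x => by
        rw [norm_apply_of_mem_unitary (hKu (hT i)), one_mul]
    have hlim : Tendsto (fun i => ContinuousLinearMapWOT.ofCLM (T i)) F
        (𝓝 (ContinuousLinearMapWOT.ofCLM U)) :=
      ContinuousLinearMapWOT.tendsto_iff_forall_inner_apply_tendsto.2 hU
    obtain ⟨U', hU', h⟩ := IsClosed.mem_of_tendsto hK hlim
      (univ_mem' fun i => ⟨T i, hT i, rfl⟩)
    obtain rfl : U' = U := ContinuousLinearMapWOT.ofCLM_injective h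
    -- Closedness makes the weak limit unitary, so no norm is lost and convergence is strong.
    refine ⟨U', hU', fun x => tendsto_of_tendsto_inner (fun i => ?_) fun y => hU x y⟩
    rw [norm_apply_of_mem_unitary (hKu (hT i)), norm_apply_of_mem_unitary (hKu hU')]

/-- The inequality `S ≤ U* T U` passes to limits, in norm for `S` and `T` and strongly for `U`. -/
lemma le_star_mul_mul_of_tendsto {ι : Type*} {F : Filter ι} [F.NeBot] {S T V : ι → H →L[ℂ] H}
    {S₀ T₀ U : H →L[ℂ] H} (hS : Tendsto S F (𝓝 S₀)) (hT : Tendsto T F (𝓝 T₀))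
    (hV : ∀ x, Tendsto (fun i => V i x) F (𝓝 (U x))) (hSa : IsSelfAdjoint S₀)
    (hTa : IsSelfAdjoint T₀) (h : ∀ᶠ i in F, S i ≤ star (V i) * T i * V i) :
    S₀ ≤ star U * T₀ * U := by
  rw [ContinuousLinearMap.le_def, ContinuousLinearMap.isPositive_def']
  refine ⟨(hTa.conjugate' U).sub hSa, fun x => ?_⟩
  have hform (P Q W : H →L[ℂ] H) : (star W * P * W - Q).reApplyInnerSelf x =
      (⟪P (W x), W x⟫).re - (⟪Q x, x⟫).re := by
    simp [ContinuousLinearMap.reApplyInnerSelf, ContinuousLinearMap.star_eq_adjoint,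
      inner_sub_left, ContinuousLinearMap.adjoint_inner_left]
  have happ {R : ι → H →L[ℂ] H} {R₀ : H →L[ℂ] H} {v : ι → H} {v₀ : H} (hR : Tendsto R F (𝓝 R₀))
      (hv : Tendsto v F (𝓝 v₀)) : Tendsto (fun i => R i (v i)) F (𝓝 (R₀ v₀)) :=
    (isBoundedBilinearMap_apply.continuous.tendsto (R₀, v₀)).comp (hR.prodMk_nhds hv)
  have hlim : Tendsto (fun i => (⟪T i (V i x), V i x⟫).re - (⟪S i x, x⟫).re) F
      (𝓝 ((⟪T₀ (U x), U x⟫).re - (⟪S₀ x, x⟫).re)) :=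
    ((Complex.continuous_re.tendsto _).comp ((happ hT (hV x)).inner (hV x))).sub
      ((Complex.continuous_re.tendsto _).comp
        ((happ hS tendsto_const_nhds).inner tendsto_const_nhds))
  rw [hform]
  refine ge_of_tendsto hlim (h.mono fun i hi => ?_)
  rw [← hform]
  exact ((ContinuousLinearMap.le_def _ _).1 hi).2 x

lemma exists_unitary_forall_pow_le_of_unitaryDominators_one {A B : H →L[ℂ] H} (hA : 0 ≤ A)
    (hB : 0 ≤ B) (hne : (unitaryDominators 1 A B).Nonempty)
    (hK : IsSOTCompact (unitaryDominators 1 A B) ∨ IsWOTClosed (unitaryDominators 1 A B)) :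
    ∃ U ∈ unitary (H →L[ℂ] H), ∀ n : ℕ, A ^ n ≤ star U * B ^ n * U := by
  obtain ⟨V, hV, hAB⟩ := hne
  rw [pow_one, pow_one] at hAB
  have hε (j : ℕ) : (0 : ℝ) < 1 / ((j : ℝ) + 1) := Nat.one_div_pos_of_nat
  -- The bound `j + 1` always covers exponent 1, where the shift cancels and gives `W j ∈ 𝒦₁`.
  choose W hW h using fun j : ℕ => exists_unitary_forall_pow_le hA hB hV hAB (hε j) (j + 1)
  have hWK (j : ℕ) : W j ∈ unitaryDominators 1 A B := by
    refine ⟨hW j, ?_⟩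
    have := h j 1 (by lia)
    rw [pow_one, pow_one, mul_add, add_mul, ← Algebra.commutes _ (star (W j)),
      mul_assoc (algebraMap ℝ (H →L[ℂ] H) _), Unitary.star_mul_self_of_mem (hW j), mul_one] at this
    simpa using le_of_add_le_add_right this
  let F : Ultrafilter ℕ := Ultrafilter.of atTop
  have hF : (F : Filter ℕ) ≤ atTop := Ultrafilter.of_le _
  obtain ⟨U, hU, hlim⟩ := exists_mem_forall_tendsto_apply (fun _ hT => hT.1) hK F W hWK
  have hpow (T : H →L[ℂ] H) (n : ℕ) :
      Tendsto (fun j : ℕ => (T + algebraMap ℝ (H →L[ℂ] H) (1 / ((j : ℝ) + 1))) ^ n) F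
        (𝓝 (T ^ n)) := by
    have h0 := ((continuous_algebraMap ℝ (H →L[ℂ] H)).tendsto 0).comp
      (tendsto_one_div_add_atTop_nhds_zero_nat (𝕜 := ℝ))
    simpa using ((h0.const_add T).pow n).mono_left hF
  refine ⟨U, hU.1, fun n => ?_⟩
  refine le_star_mul_mul_of_tendsto (hpow A n) (hpow B n) hlim (hA.isSelfAdjoint.pow n)
    (hB.isSelfAdjoint.pow n) (hF ?_)
  filter_upwards [eventually_ge_atTop n] with j hj using h j n (by lia)

end Limit

theorem theorem2p9 {H : Type*} [NormedAddCommGroup H] [InnerProductSpace ℂ H] [CompleteSpace H]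
    (A B : H →L[ℂ] H) (hA : A.IsPositive) (hB : B.IsPositive)
    (n₀ : ℕ) (hn₀ : 1 ≤ n₀)
    (hne : (unitaryDominators n₀ A B).Nonempty)
    (hK : IsSOTCompact (unitaryDominators n₀ A B) ∨ IsWOTClosed (unitaryDominators n₀ A B)) :
    ∃ U ∈ unitary (H →L[ℂ] H), ∀ n : ℕ, 1 ≤ n → A ^ n ≤ star U * B ^ n * U := by
  have hA' : 0 ≤ A := A.nonneg_iff_isPositive.2 hA
  have hB' : 0 ≤ B := B.nonneg_iff_isPositive.2 hB
  have hKeq : unitaryDominators n₀ A B = unitaryDominators 1 (A ^ n₀) (B ^ n₀) := by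
    simp [unitaryDominators]
  rw [hKeq] at hne hK
  obtain ⟨U, hU, h⟩ := exists_unitary_forall_pow_le_of_unitaryDominators_one
    (CStarAlgebra.pow_nonneg hA' n₀) (CStarAlgebra.pow_nonneg hB' n₀) hne hK
  refine ⟨U, hU, fun n hn => ?_⟩
  have hn' := h n
  rw [← pow_mul, ← pow_mul, ← star_mul_mul_pow_of_mem_unitary hU] at hn'
  rw [← star_mul_mul_pow_of_mem_unitary hU]
  -- Löwner–Heinz descends from exponent `n₀ * n` to `n`, comparing `A` with `U⋆ B U`.
  exact pow_le_pow_of_pow_le_pow hA' (star_left_conjugate_nonneg hB' U) (by positivity)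
    (Nat.le_mul_of_pos_left n hn₀) hn'
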